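/- Let $(W_s,W_v)$ be a pair of standard Brownian motions on a probability space, jointly Gaussian, with $\operatorname{Cov}(W_{s,r},W_{v,t})=\rho_{sv}\min(r,t)$ for all $r,t\ge 0$ (that is, $\operatorname{corr}(dW_{s,t},dW_{v,t})=\rho_{sv}$). Let $\lambda_s,\mu_s,\sigma_s,\mu_v,\beta_v,\gamma_v,\sigma_v$ be real parameters, and let the sentiment process $S$ and the volatility process $V$ have almost surely continuous paths, start at constants $S_0,V_0\in\mathbb{R}$, and solve $$dS_t=\lambda_s(\mu_s-S_t)\,dt+\sigma_s\,dW_{s,t},\qquad dV_t=\bigl(\mu_v+\beta_v(S_t-\mu_s)^2-\gamma_vV_t\bigr)\,dt+\sigma_v\,dW_{v,t}.$$ Then $V_t^2$, $V_t$, $S_tV_t$ and $S_t^2V_t$ are integrable for every $t\ge 0$, and for every $t\ge0$ the integrand of the following time integral is integrable on $[0,t]$ and $$\mathbb{E}[V_t^2]=e^{-2\gamma_vt}V_0^2+\int_0^te^{2\gamma_v(u-t)}\Bigl(2\bigl[\mu_v+\beta_v\mu_s^2\bigr]\mathbb{E}[V_u]-4\beta_v\mu_s\,\mathbb{E}[S_uV_u]+2\beta_v\,\mathbb{E}[S_u^2V_u]+\sigma_v^2\Bigr)\,du.$$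 -/

import Mathlib

open MeasureTheory ProbabilityTheory
open scoped NNReal

namespace SSV

/-- `W₁` and `W₂` are two standard Brownian motions with `corr(dW₁, dW₂) = ρ`: each of them is a
standard Brownian motion, they are jointly Gaussian, and `Cov(W₁(s), W₂(t)) = ρ min(s, t)`. -/
structure IsCorrelatedBrownianPair {Ω : Type*} [MeasurableSpace Ω]
    (W₁ W₂ : ℝ≥0 → Ω → ℝ) (ρ : ℝ) (P : Measure Ω) : Prop where
  brownian_fst : IsBrownianReal W₁ P
  brownian_snd : IsBrownianReal W₂ P
  jointly_gaussian : IsGaussianProcess (Sum.elim W₁ W₂ : ℝ≥0 ⊕ ℝ≥0 → Ω → ℝ) P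
  covariance_eq : ∀ s t : ℝ≥0, cov[W₁ s, W₂ t; P] = ρ * (min s t : ℝ≥0)

/-- The real process `X` has almost surely continuous paths and solves
`dX_t = b_t dt + σ dW_t`, `X_0 = x₀`, i.e. almost surely, for all `t ≥ 0`,
`X_t = x₀ + ∫_0^t b_u du + σ W_t` (the noise is additive with constant `σ`, and `W_0 = 0`, so that
`∫_0^t σ dW_u = σ W_t`). The drift `b` is a process, in applications a function of the state. -/
structure SolvesAdditiveSDE {Ω : Type*} [MeasurableSpace Ω]
    (X : ℝ≥0 → Ω → ℝ) (x₀ : ℝ) (b : ℝ≥0 → Ω → ℝ) (σ : ℝ) (W : ℝ≥0 → Ω → ℝ)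
    (P : Measure Ω) : Prop where
  continuous_paths : ∀ᵐ ω ∂P, Continuous (fun t => X t ω)
  integral_eq : ∀ᵐ ω ∂P, ∀ t : ℝ≥0,
    X t ω = x₀ + (∫ u in (0 : ℝ)..t, b u.toNNReal ω) + σ * W t ω

/-- The sentiment and volatility components `(S, V)` of the sentiment-driven stochastic volatility
model, started at the constants `(S₀, V₀)` and driven by `(Ws, Wv)`:
`dS_t = lamS (muS - S_t) dt + sigS dWs_t`,
`dV_t = (muV + betaV (S_t - muS)^2 - gamV V_t) dt + sigV dWv_t`, `corr(dWs, dWv) = rho`. -/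
structure IsSentimentVolatility {Ω : Type*} [MeasurableSpace Ω]
    (lamS muS sigS muV betaV gamV sigV rho S₀ V₀ : ℝ)
    (Ws Wv S V : ℝ≥0 → Ω → ℝ) (P : Measure Ω) : Prop where
  noise : IsCorrelatedBrownianPair Ws Wv rho P
  sentiment : SolvesAdditiveSDE S S₀ (fun t ω => lamS * (muS - S t ω)) sigS Ws P
  volatility : SolvesAdditiveSDE V V₀
    (fun t ω => muV + betaV * (S t ω - muS) ^ 2 - gamV * V t ω) sigV Wv P

end SSV

/-! Formally, Itô's formula for V² gives m' = 2 E[V F] + σ² - 2γ m, where m = E[V²] and F = μ_v +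
β_v (S - μ_s)²; an integrating factor and the expansion of E[V F] finish. As the noise is additive,
stochastic integrals can be avoided: A = V - σW is C¹ in time with derivative b = F - γV, and V² =
A² + 2σAW + σ²W². The mean of A² comes from the ordinary chain rule, that of AW from E[b_u W_s] =
E[b_u W_u] for u ≤ s, and E[W_s²] = s supplies the Itô term (`integral_linearSolution_sq`).

What remains is the orthogonality of b_u to W_s - W_u. By variation of constants S is affine in the
past of Ws, and V is affine in the past of F and Wv. Everything thus reduces to at most two past
values of Ws, or one of Wv, multiplied by a later increment of Wv. Such products have mean zero
because the past of either Brownian motion is independent of that increment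
(`indepFun_past_increment`). The class `HasLocalMoments`, stable under products and time integrals,
provides integrability and justifies Fubini. -/

namespace SSV

/-! ### Processes with locally bounded moments -/

/-- A real process indexed by `ℝ` with continuous paths and measurable marginals, all of whose
moments are bounded on every interval `[0, T]`. -/
structure HasLocalMoments {Ω : Type*} [MeasurableSpace Ω] (P : Measure Ω) (X : ℝ → Ω → ℝ) :
    Prop where
  continuous_path : ∀ ω, Continuous fun t => X t ω
  measurable_eval : ∀ t, Measurable (X t)
  moment_le : ∀ (n : ℕ) (T : ℝ), ∃ C : ℝ≥0, ∀ t ∈ Set.Icc 0 T, ∫⁻ ω, ‖X t ω‖ₑ ^ n ∂P ≤ C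

/-- Hölder's inequality between exponents 1 and n, raised to the power n. It bounds the moments of a
time integral in `HasLocalMoments.primitive`. -/
lemma lintegral_enorm_pow_le {α : Type*} [MeasurableSpace α] (μ : Measure α) {f : α → ℝ}
    (hf : AEStronglyMeasurable f μ) {n : ℕ} (hn : 1 ≤ n) :
    (∫⁻ x, ‖f x‖ₑ ∂μ) ^ n ≤ (∫⁻ x, ‖f x‖ₑ ^ n ∂μ) * μ Set.univ ^ (n - 1) := by
  have hn' : (1 : ℝ) ≤ n := by exact_mod_cast hn
  have h := eLpNorm'_le_eLpNorm'_mul_rpow_measure_univ (p := 1) (q := n) one_pos hn' hf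
  simp only [eLpNorm', ENNReal.rpow_one, div_one, ENNReal.rpow_natCast] at h
  calc (∫⁻ x, ‖f x‖ₑ ∂μ) ^ n
      ≤ ((∫⁻ x, ‖f x‖ₑ ^ n ∂μ) ^ (1 / (n : ℝ)) * μ Set.univ ^ (1 - 1 / (n : ℝ))) ^ n := by
        gcongr
    _ = _ := by
      rw [mul_pow, ← ENNReal.rpow_natCast, ← ENNReal.rpow_natCast, ← ENNReal.rpow_mul,
        ← ENNReal.rpow_mul, one_div, inv_mul_cancel₀ (by positivity), ENNReal.rpow_one,
        ← ENNReal.rpow_natCast]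
      congr 2
      rw [Nat.cast_sub hn]
      field_simp
      simp

namespace HasLocalMoments

variable {Ω : Type*} [MeasurableSpace Ω] {P : Measure Ω} {X Y : ℝ → Ω → ℝ}

lemma measurable_uncurry (hX : HasLocalMoments P X) : Measurable (Function.uncurry X) :=
  measurable_uncurry_of_continuous_of_measurable hX.continuous_path hX.measurable_eval

lemma of_continuous [IsProbabilityMeasure P] {f : ℝ → ℝ} (hf : Continuous f) :
    HasLocalMoments P fun t _ => f t where
  continuous_path _ := hf
  measurable_eval _ := measurable_const
  moment_le n T := by
    obtain ⟨C, hC⟩ := (isCompact_Icc (a := (0 : ℝ)) (b := T)).exists_bound_of_continuousOn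
      hf.continuousOn
    refine ⟨(Real.toNNReal C) ^ n, fun t ht => ?_⟩
    simp only [lintegral_const, measure_univ, mul_one, ENNReal.coe_pow]
    gcongr
    rw [← ofReal_norm]
    exact ENNReal.ofReal_le_ofReal (hC t ht)

lemma add (hX : HasLocalMoments P X) (hY : HasLocalMoments P Y) :
    HasLocalMoments P fun t ω => X t ω + Y t ω where
  continuous_path ω := (hX.continuous_path ω).add (hY.continuous_path ω)
  measurable_eval t := (hX.measurable_eval t).add (hY.measurable_eval t)
  moment_le n T := by
    obtain ⟨C, hC⟩ := hX.moment_le n T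
    obtain ⟨D, hD⟩ := hY.moment_le n T
    refine ⟨2 ^ n * (C + D), fun t ht => ?_⟩
    have key : ∀ a b : ENNReal, (a + b) ^ n ≤ 2 ^ n * (a ^ n + b ^ n) := fun a b =>
      calc (a + b) ^ n ≤ (2 * max a b) ^ n := by
            rw [two_mul]; gcongr; exacts [le_max_left _ _, le_max_right _ _]
        _ = 2 ^ n * (max a b) ^ n := mul_pow _ _ _
        _ ≤ 2 ^ n * (a ^ n + b ^ n) := by
          gcongr
          rcases max_choice a b with h | h <;> rw [h]
          exacts [le_self_add, le_add_self]
    have hXn : Measurable fun ω => ‖X t ω‖ₑ ^ n := (hX.measurable_eval t).enorm.pow_const n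
    calc ∫⁻ ω, ‖X t ω + Y t ω‖ₑ ^ n ∂P
        ≤ ∫⁻ ω, 2 ^ n * (‖X t ω‖ₑ ^ n + ‖Y t ω‖ₑ ^ n) ∂P := lintegral_mono fun ω =>
          (pow_le_pow_left₀ zero_le (enorm_add_le _ _) n).trans (key _ _)
      _ = 2 ^ n * (∫⁻ ω, ‖X t ω‖ₑ ^ n ∂P + ∫⁻ ω, ‖Y t ω‖ₑ ^ n ∂P) := by
          rw [lintegral_const_mul' _ _ (by finiteness), lintegral_add_left hXn]
      _ ≤ _ := by
          push_cast
          gcongr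
          exacts [hC t ht, hD t ht]

/-- An n-th moment of a product costs moments of order 2n of the factors; stability under products
is the reason for requiring all orders in the class. -/
lemma mul (hX : HasLocalMoments P X) (hY : HasLocalMoments P Y) :
    HasLocalMoments P fun t ω => X t ω * Y t ω where
  continuous_path ω := (hX.continuous_path ω).mul (hY.continuous_path ω)
  measurable_eval t := (hX.measurable_eval t).mul (hY.measurable_eval t)
  moment_le n T := by
    obtain ⟨C, hC⟩ := hX.moment_le (2 * n) T
    obtain ⟨D, hD⟩ := hY.moment_le (2 * n) T
    refine ⟨C + D, fun t ht => ?_⟩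
    have key : ∀ a b : ENNReal, (a * b) ^ n ≤ a ^ (2 * n) + b ^ (2 * n) := fun a b =>
      calc (a * b) ^ n ≤ (max a b * max a b) ^ n := by
            gcongr; exacts [le_max_left _ _, le_max_right _ _]
        _ = (max a b) ^ (2 * n) := by rw [← sq, pow_mul]
        _ ≤ a ^ (2 * n) + b ^ (2 * n) := by
          rcases max_choice a b with h | h <;> rw [h]
          exacts [le_self_add, le_add_self]
    have hXn : Measurable fun ω => ‖X t ω‖ₑ ^ (2 * n) := (hX.measurable_eval t).enorm.pow_const _
    calc ∫⁻ ω, ‖X t ω * Y t ω‖ₑ ^ n ∂P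
        ≤ ∫⁻ ω, (‖X t ω‖ₑ ^ (2 * n) + ‖Y t ω‖ₑ ^ (2 * n)) ∂P := lintegral_mono fun ω => by
          simpa only [enorm_mul] using key _ _
      _ = ∫⁻ ω, ‖X t ω‖ₑ ^ (2 * n) ∂P + ∫⁻ ω, ‖Y t ω‖ₑ ^ (2 * n) ∂P := lintegral_add_left hXn _
      _ ≤ _ := by
          push_cast
          gcongr
          exacts [hC t ht, hD t ht]

lemma pow_two (hX : HasLocalMoments P X) : HasLocalMoments P fun t ω => X t ω ^ 2 := by
  simpa [sq] using hX.mul hX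

lemma integrable (hX : HasLocalMoments P X) {t : ℝ} (ht : 0 ≤ t) : Integrable (X t) P := by
  obtain ⟨C, hC⟩ := hX.moment_le 1 t
  refine ⟨(hX.measurable_eval t).aestronglyMeasurable, ?_⟩
  have := hC t ⟨ht, le_rfl⟩
  simp only [pow_one] at this
  exact this.trans_lt ENNReal.coe_lt_top

/-- Freezing the time turns a random variable into a constant process, so that products of values at
different times stay within the class. -/
lemma fixed (hX : HasLocalMoments P X) {t : ℝ} (ht : 0 ≤ t) : HasLocalMoments P fun _ => X t where
  continuous_path _ := continuous_const
  measurable_eval _ := hX.measurable_eval t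
  moment_le n _ := by
    obtain ⟨C, hC⟩ := hX.moment_le n t
    exact ⟨C, fun _ _ => hC t ⟨ht, le_rfl⟩⟩

variable [IsProbabilityMeasure P]

lemma const_mul (hX : HasLocalMoments P X) (c : ℝ) : HasLocalMoments P fun t ω => c * X t ω :=
  (of_continuous continuous_const).mul hX

lemma sub (hX : HasLocalMoments P X) (hY : HasLocalMoments P Y) :
    HasLocalMoments P fun t ω => X t ω - Y t ω := by
  simpa [sub_eq_add_neg] using hX.add (hY.const_mul (-1))

/-- Hölder in time moves the n-th power inside the time integral, and Tonelli then exchanges it with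
the expectation. -/
lemma primitive (hX : HasLocalMoments P X) :
    HasLocalMoments P fun t ω => ∫ u in (0 : ℝ)..t, X u ω where
  continuous_path ω := intervalIntegral.continuous_primitive
    (fun a b => (hX.continuous_path ω).intervalIntegrable a b) 0
  measurable_eval t := by
    have h : StronglyMeasurable (Function.uncurry X) := hX.measurable_uncurry.stronglyMeasurable
    simp only [intervalIntegral]
    exact (h.integral_prod_left.sub h.integral_prod_left).measurable
  moment_le n T := by
    rcases Nat.eq_zero_or_pos n with rfl | hn
    · exact ⟨1, fun t _ => by simp⟩
    obtain ⟨C, hC⟩ := hX.moment_le n T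
    refine ⟨(C * T.toNNReal) * T.toNNReal ^ (n - 1), fun t ht => ?_⟩
    have hvol : volume.restrict (Set.Ioc 0 t) Set.univ ≤ T.toNNReal := by
      simpa using Or.inl ht.2
    have hmeas : Measurable fun p : ℝ × Ω => ‖X p.1 p.2‖ₑ ^ n :=
      hX.measurable_uncurry.enorm.pow_const n
    calc ∫⁻ ω, ‖∫ u in (0 : ℝ)..t, X u ω‖ₑ ^ n ∂P
        ≤ ∫⁻ ω, (∫⁻ u in Set.Ioc 0 t, ‖X u ω‖ₑ ^ n) * T.toNNReal ^ (n - 1) ∂P := by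
          refine lintegral_mono fun ω => ?_
          rw [intervalIntegral.integral_of_le ht.1]
          refine (pow_le_pow_left₀ zero_le (enorm_integral_le_lintegral_enorm _) n).trans ?_
          refine (lintegral_enorm_pow_le _
            (hX.continuous_path ω).aestronglyMeasurable hn).trans ?_
          gcongr
      _ = (∫⁻ u in Set.Ioc 0 t, ∫⁻ ω, ‖X u ω‖ₑ ^ n ∂P) * T.toNNReal ^ (n - 1) := by
          rw [lintegral_mul_const' _ _ (by finiteness), lintegral_lintegral_swap]
          exact (hmeas.comp measurable_swap).aemeasurable
      _ ≤ (∫⁻ _u in Set.Ioc 0 t, (C : ENNReal)) * T.toNNReal ^ (n - 1) := by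
          gcongr 1
          refine setLIntegral_mono measurable_const fun u hu => hC u ⟨hu.1.le, hu.2.trans ht.2⟩
      _ ≤ _ := by
          rw [lintegral_const]
          push_cast
          gcongr

lemma integrable_prod (hX : HasLocalMoments P X) {t : ℝ} (ht : 0 ≤ t) :
    Integrable (Function.uncurry X) ((volume.restrict (Set.uIoc 0 t)).prod P) := by
  refine ⟨hX.measurable_uncurry.aestronglyMeasurable, ?_⟩
  obtain ⟨C, hC⟩ := hX.moment_le 1 t
  simp only [pow_one] at hC
  rw [Set.uIoc_of_le ht, HasFiniteIntegral,
    lintegral_prod _ hX.measurable_uncurry.enorm.aemeasurable]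
  calc ∫⁻ u in Set.Ioc 0 t, ∫⁻ ω, ‖X u ω‖ₑ ∂P
      ≤ ∫⁻ _u in Set.Ioc 0 t, (C : ENNReal) :=
        setLIntegral_mono measurable_const fun u hu => hC u ⟨hu.1.le, hu.2⟩
    _ < ⊤ := by
      rw [lintegral_const]
      simp [ENNReal.mul_lt_top]

lemma integral_primitive (hX : HasLocalMoments P X) {t : ℝ} (ht : 0 ≤ t) :
    ∫ ω, (∫ u in (0 : ℝ)..t, X u ω) ∂P = ∫ u in (0 : ℝ)..t, ∫ ω, X u ω ∂P :=
  (intervalIntegral_integral_swap (hX.integrable_prod ht)).symm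

lemma intervalIntegrable_integral (hX : HasLocalMoments P X) {t : ℝ} (ht : 0 ≤ t) :
    IntervalIntegrable (fun u => ∫ ω, X u ω ∂P) volume 0 t := by
  rw [intervalIntegrable_iff]
  exact (hX.integrable_prod ht).integral_prod_left

/-- If a random variable is orthogonal to a process up to time `t`, it is orthogonal to the
time integral of that process. -/
lemma integral_primitive_mul_eq_zero (hX : HasLocalMoments P X) {Z : Ω → ℝ}
    (hZ : HasLocalMoments P fun _ => Z) {t : ℝ} (ht : 0 ≤ t)
    (h : ∀ r ∈ Set.Icc 0 t, ∫ ω, X r ω * Z ω ∂P = 0) :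
    ∫ ω, (∫ u in (0 : ℝ)..t, X u ω) * Z ω ∂P = 0 := by
  simp_rw [← intervalIntegral.integral_mul_const]
  rw [(hX.mul hZ).integral_primitive ht]
  rw [intervalIntegral.integral_congr (g := fun _ => 0)]
  · simp
  · intro r hr
    rw [Set.uIcc_of_le ht] at hr
    exact h r hr

end HasLocalMoments

end SSV

/-! ### Linear equations with additive noise, and regular modifications -/

namespace SSV

/-- The solution of `dX = (f - γ X) dt + σ dw`, `X 0 = x₀`, by variation of constants. The
stochastic convolution is written with an integration by parts, so that no stochastic integral
is needed. -/
noncomputable def linearSolution (γ σ x₀ : ℝ) (f w : ℝ → ℝ) (t : ℝ) : ℝ :=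
  Real.exp (-(γ * t)) * (x₀ + ∫ u in (0 : ℝ)..t, Real.exp (γ * u) * (f u - γ * σ * w u)) + σ * w t

/-- Subtracting the noise leaves a differentiable function although w is only continuous; ordinary
calculus can therefore replace Itô's formula. -/
lemma hasDerivAt_linearSolution_sub {γ σ x₀ : ℝ} {f w : ℝ → ℝ} (hf : Continuous f)
    (hw : Continuous w) (t : ℝ) :
    HasDerivAt (fun t => linearSolution γ σ x₀ f w t - σ * w t)
      (f t - γ * linearSolution γ σ x₀ f w t) t := by
  have hc : Continuous fun u => Real.exp (γ * u) * (f u - γ * σ * w u) := by fun_prop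
  have h1 := (hc.integral_hasStrictDerivAt 0 t).hasDerivAt.const_add x₀
  have h2 : HasDerivAt (fun t => Real.exp (-(γ * t))) (Real.exp (-(γ * t)) * -(γ * 1)) t :=
    (((hasDerivAt_id t).const_mul γ).neg).exp
  have hfun : (fun t => linearSolution γ σ x₀ f w t - σ * w t) =
      (fun t => Real.exp (-(γ * t))) *
        fun t => x₀ + ∫ u in (0 : ℝ)..t, Real.exp (γ * u) * (f u - γ * σ * w u) := by
    ext
    simp [linearSolution]
  have hexp : Real.exp (-(γ * t)) * Real.exp (γ * t) = 1 := by simp [← Real.exp_add]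
  rw [hfun]
  refine (h2.mul h1).congr_deriv ?_
  simp only [linearSolution]
  linear_combination (f t - γ * σ * w t) * hexp

/-- Uniqueness, by the integrating factor exp(γu) applied to the differentiable part y = x - σw. -/
lemma eq_linearSolution {γ σ x₀ : ℝ} {f w x : ℝ → ℝ} (hf : Continuous f) (hx : Continuous x)
    (h : ∀ t, 0 ≤ t → x t = x₀ + (∫ u in (0 : ℝ)..t, (f u - γ * x u)) + σ * w t)
    {t : ℝ} (ht : 0 ≤ t) : x t = linearSolution γ σ x₀ f w t := by
  set y : ℝ → ℝ := fun t => x₀ + ∫ u in (0 : ℝ)..t, (f u - γ * x u) with hy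
  have hb : Continuous fun u => f u - γ * x u := by fun_prop
  have hyd : ∀ u, HasDerivAt y (f u - γ * x u) u := fun u =>
    (hb.integral_hasStrictDerivAt 0 u).hasDerivAt.const_add x₀
  have hyc : Continuous y := continuous_iff_continuousAt.2 fun u => (hyd u).continuousAt
  have hxy : ∀ u, 0 ≤ u → x u = y u + σ * w u := h
  have hd : ∀ u, HasDerivAt (fun u => Real.exp (γ * u) * y u)
      (Real.exp (γ * u) * (γ * 1) * y u + Real.exp (γ * u) * (f u - γ * x u)) u := fun u =>
    ((hasDerivAt_id u).const_mul γ).exp.mul (hyd u)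
  have hint := intervalIntegral.integral_eq_sub_of_hasDerivAt (a := 0) (b := t)
    (fun u _ => hd u) (Continuous.intervalIntegrable (by fun_prop) _ _)
  have hcongr : (∫ u in (0 : ℝ)..t, Real.exp (γ * u) * (f u - γ * σ * w u)) =
      Real.exp (γ * t) * y t - x₀ := by
    rw [intervalIntegral.integral_congr (g := fun u =>
      Real.exp (γ * u) * (γ * 1) * y u + Real.exp (γ * u) * (f u - γ * x u)), hint]
    · simp [hy]
    · intro u hu
      rw [Set.uIcc_of_le ht] at hu
      simp only [hxy u hu.1]
      ring
  have hexp : Real.exp (-(γ * t)) * Real.exp (γ * t) = 1 := by simp [← Real.exp_add]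
  rw [linearSolution, hcongr, hxy t ht]
  linear_combination -y t * hexp

/-- Variation of constants for `m' = g - c m` with merely integrable `g`. -/
lemma eq_exp_mul_add_integral {c m₀ : ℝ} {m g : ℝ → ℝ} {t : ℝ}
    (hg : IntervalIntegrable g volume 0 t) (hm : IntervalIntegrable m volume 0 t)
    (h : ∀ s ∈ Set.uIcc 0 t, m s = m₀ + ∫ u in (0 : ℝ)..s, (g u - c * m u)) :
    m t = Real.exp (-c * t) * m₀ + ∫ u in (0 : ℝ)..t, Real.exp (c * (u - t)) * g u := by
  set k : ℝ → ℝ := fun u => g u - c * m u with hk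
  have hki : IntervalIntegrable k volume 0 t := hg.sub (hm.const_mul c)
  have hE : ∀ u, HasDerivAt (fun u => Real.exp (c * (u - t))) (Real.exp (c * (u - t)) * (c * 1)) u :=
    fun u => (((hasDerivAt_id u).sub_const t).const_mul c).exp
  -- The primitive of k is only absolutely continuous, with derivative k almost everywhere, so
  -- integration by parts is used in its absolutely continuous form.
  have hE_ac : AbsolutelyContinuousOnInterval (fun u => Real.exp (c * (u - t))) 0 t := by
    have hc : ContDiff ℝ 1 fun u => Real.exp (c * (u - t)) := by fun_prop
    exact hc.contDiffOn.absolutelyContinuousOnInterval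
  have hI := hki.absolutelyContinuousOnInterval_intervalIntegral (c := 0) Set.left_mem_uIcc
  have hparts := hE_ac.integral_mul_deriv_eq_deriv_mul hI
  have h1 : (∫ u in (0 : ℝ)..t, Real.exp (c * (u - t)) * deriv (fun s => ∫ v in (0 : ℝ)..s, k v) u) =
      ∫ u in (0 : ℝ)..t, Real.exp (c * (u - t)) * k u := by
    refine intervalIntegral.integral_congr_ae ?_
    filter_upwards [hki.ae_hasDerivAt_integral] with u hu hut
    rw [(hu (Set.uIoc_subset_uIcc hut) 0 Set.left_mem_uIcc).deriv]
  have hEc : Continuous fun u => Real.exp (c * (u - t)) := by fun_prop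
  -- By hypothesis the primitive of k is m - m₀.
  have h2 : (∫ u in (0 : ℝ)..t, deriv (fun u => Real.exp (c * (u - t))) u *
      ∫ v in (0 : ℝ)..u, k v) = (∫ u in (0 : ℝ)..t, Real.exp (c * (u - t)) * (c * m u)) -
        m₀ * ∫ u in (0 : ℝ)..t, Real.exp (c * (u - t)) * (c * 1) := by
    rw [← intervalIntegral.integral_const_mul, ← intervalIntegral.integral_sub
      ((hm.const_mul c).continuousOn_mul hEc.continuousOn)
      (Continuous.intervalIntegrable (by fun_prop) _ _)]
    refine intervalIntegral.integral_congr fun u hu => ?_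
    simp only [(hE u).deriv, h u hu]
    ring
  have h3 := intervalIntegral.integral_eq_sub_of_hasDerivAt (a := 0) (b := t)
    (fun u _ => hE u) (Continuous.intervalIntegrable (by fun_prop) _ _)
  rw [h1, h2, h3] at hparts
  have h4 : (∫ u in (0 : ℝ)..t, Real.exp (c * (u - t)) * g u) =
      (∫ u in (0 : ℝ)..t, Real.exp (c * (u - t)) * k u) +
        ∫ u in (0 : ℝ)..t, Real.exp (c * (u - t)) * (c * m u) := by
    rw [← intervalIntegral.integral_add (hki.continuousOn_mul hEc.continuousOn)
      ((hm.const_mul c).continuousOn_mul hEc.continuousOn)]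
    refine intervalIntegral.integral_congr fun u _ => ?_
    simp only [hk]
    ring
  rw [h4, hparts, h t Set.right_mem_uIcc]
  rw [show -c * t = c * (0 - t) by ring]
  simp only [sub_self, mul_zero, Real.exp_zero, intervalIntegral.integral_same]
  ring

variable {Ω : Type*} [MeasurableSpace Ω] {P : Measure Ω}

/-- A process with measurable marginals and almost surely continuous paths is indistinguishable
from one whose paths are all continuous and whose marginals are Borel measurable. -/
lemma exists_continuous_modification {X : ℝ≥0 → Ω → ℝ} (hX : ∀ t, AEMeasurable (X t) P)
    (hc : ∀ᵐ ω ∂P, Continuous fun t => X t ω) :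
    ∃ Y : ℝ≥0 → Ω → ℝ, (∀ t, Measurable (Y t)) ∧ (∀ ω, Continuous fun t => Y t ω) ∧
      ∀ᵐ ω ∂P, ∀ t, X t ω = Y t ω := by
  classical
  obtain ⟨D, hDc, hDd⟩ := TopologicalSpace.exists_countable_dense ℝ≥0
  have hmk : ∀ᵐ ω ∂P, ∀ t ∈ D, X t ω = (hX t).mk _ ω :=
    (ae_ball_iff hDc).2 fun t _ => (hX t).ae_eq_mk
  -- N is a measurable null set containing every path that is discontinuous or differs on D from the
  -- measurable versions. Off N, the values at any time are limits of values along D.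
  obtain ⟨N, hN, hNm, hN0⟩ := exists_measurable_superset_of_null (ae_iff.1 (hc.and hmk))
  have hgood : ∀ ω, ω ∉ N → (Continuous fun t => X t ω) ∧ ∀ t ∈ D, X t ω = (hX t).mk _ ω :=
    fun ω hω => by_contra fun h => hω (hN h)
  refine ⟨fun t ω => if ω ∈ N then 0 else X t ω, fun t => ?_, fun ω => ?_, ?_⟩
  · obtain ⟨q, hq, hqt⟩ := mem_closure_iff_seq_limit.1 (hDd t)
    refine measurable_of_tendsto_metrizable
      (f := fun n ω => if ω ∈ N then 0 else (hX (q n)).mk _ ω)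
      (fun n => Measurable.ite hNm measurable_const (hX (q n)).measurable_mk) ?_
    rw [tendsto_pi_nhds]
    intro ω
    by_cases hω : ω ∈ N
    · simp [hω]
    · simp only [hω, if_false]
      simp_rw [← fun n => (hgood ω hω).2 (q n) (hq n)]
      exact ((hgood ω hω).1.tendsto t).comp hqt
  · by_cases hω : ω ∈ N
    · simp only [hω, if_true]
      exact continuous_const
    · simp only [hω, if_false]
      exact (hgood ω hω).1
  · filter_upwards [measure_eq_zero_iff_ae_notMem.1 hN0] with ω hω t
    simp [hω]

variable [IsProbabilityMeasure P]

lemma HasLocalMoments.linearSolution {F W : ℝ → Ω → ℝ} (hF : HasLocalMoments P F)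
    (hW : HasLocalMoments P W) (γ σ x₀ : ℝ) :
    HasLocalMoments P fun t ω => linearSolution γ σ x₀ (F · ω) (W · ω) t :=
  have hexp (c : ℝ) : HasLocalMoments P fun t _ => Real.exp (c * t) :=
    of_continuous (by fun_prop)
  by simpa only [SSV.linearSolution, neg_mul] using
    ((hexp (-γ)).mul ((of_continuous continuous_const).add
      ((hexp γ).mul (hF.sub (hW.const_mul (γ * σ)))).primitive)).add (hW.const_mul σ)

/-- A random variable that is centred and orthogonal to the forcing terms up to time `u` is
orthogonal to the solution of the linear equation up to time `u`. -/
lemma integral_linearSolution_mul_eq_zero {F W : ℝ → Ω → ℝ} (hF : HasLocalMoments P F)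
    (hW : HasLocalMoments P W) (γ σ x₀ : ℝ) {Z : Ω → ℝ} (hZ : HasLocalMoments P fun _ => Z)
    (hZ0 : ∫ ω, Z ω ∂P = 0) {t : ℝ} (ht : 0 ≤ t)
    (hFZ : ∀ r ∈ Set.Icc 0 t, ∫ ω, F r ω * Z ω ∂P = 0)
    (hWZ : ∀ r ∈ Set.Icc 0 t, ∫ ω, W r ω * Z ω ∂P = 0) :
    ∫ ω, linearSolution γ σ x₀ (F · ω) (W · ω) t * Z ω ∂P = 0 := by
  have hexp : HasLocalMoments P fun t _ => Real.exp (γ * t) := .of_continuous (by fun_prop)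
  have hG := hexp.mul (hF.sub (hW.const_mul (γ * σ)))
  have hGZ := hG.integral_primitive_mul_eq_zero hZ ht fun r hr => by
    have h1 := ((hF.mul hZ).integrable hr.1).const_mul (Real.exp (γ * r))
    have h2 := ((hW.mul hZ).integrable hr.1).const_mul (Real.exp (γ * r) * (γ * σ))
    calc _ = ∫ ω, (Real.exp (γ * r) * (F r ω * Z ω) -
          Real.exp (γ * r) * (γ * σ) * (W r ω * Z ω)) ∂P := by congr with ω; ring
      _ = 0 := by
        rw [integral_sub h1 h2, integral_const_mul, integral_const_mul, hFZ r hr, hWZ r hr]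
        simp
  have h1 := (hZ.integrable ht).const_mul (Real.exp (-(γ * t)) * x₀)
  have h2 := ((hG.primitive.mul hZ).integrable ht).const_mul (Real.exp (-(γ * t)))
  have h3 := ((hW.mul hZ).integrable ht).const_mul σ
  calc _ = ∫ ω, (Real.exp (-(γ * t)) * x₀ * Z ω + Real.exp (-(γ * t)) *
        ((∫ u in (0 : ℝ)..t, Real.exp (γ * u) * (F u ω - γ * σ * W u ω)) * Z ω) +
          σ * (W t ω * Z ω)) ∂P := by
        congr with ω; simp only [linearSolution]; ring
    _ = 0 := by
      rw [integral_add (by exact h1.add h2) h3, integral_add h1 h2,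
        integral_const_mul, integral_const_mul, integral_const_mul, hZ0, hGZ, hWZ t ⟨ht, le_rfl⟩]
      simp

end SSV

/-! ### Brownian moments, the second moment formula, independence of increments -/

namespace SSV

variable {Ω : Type*} [MeasurableSpace Ω] {P : Measure Ω}

/-- By scaling, N(0, t) is the law of √t times a standard normal variable, so the n-th moment is
largest at the end of [0, T]. -/
lemma _root_.ProbabilityTheory.IsBrownianReal.exists_hasLocalMoments {W : ℝ≥0 → Ω → ℝ}
    (hW : IsBrownianReal W P) :
    ∃ w : ℝ → Ω → ℝ, HasLocalMoments P w ∧ ∀ᵐ ω ∂P, ∀ t : ℝ≥0, W t ω = w t ω := by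
  obtain ⟨Y, hYm, hYc, hY⟩ := exists_continuous_modification hW.aemeasurable hW.cont
  refine ⟨fun t => Y t.toNNReal, ⟨fun ω => (hYc ω).comp continuous_real_toNNReal,
    fun t => hYm _, fun n T => ?_⟩, by simpa using hY⟩
  have hZ : (∫⁻ x, ‖x‖ₑ ^ n ∂gaussianReal 0 1) ≠ ⊤ := by
    rcases Nat.eq_zero_or_pos n with rfl | hn
    · simp
    have h := (memLp_id_gaussianReal (μ := 0) (v := 1) n).eLpNorm_ne_top
    have hn' : (n : ENNReal) ≠ 0 := by exact_mod_cast hn.ne'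
    have := (lintegral_rpow_enorm_lt_top_of_eLpNorm_lt_top hn' (by simp) h.lt_top).ne
    simpa using this
  refine ⟨Real.toNNReal √T ^ n * (∫⁻ x, ‖x‖ₑ ^ n ∂gaussianReal 0 1).toNNReal, fun t ht => ?_⟩
  have hlaw : gaussianReal 0 t.toNNReal = (gaussianReal 0 1).map (√t * ·) := by
    rw [gaussianReal_map_const_mul]
    congr 1
    · simp
    · ext
      simp [Real.sq_sqrt ht.1, ht.1]
  calc ∫⁻ ω, ‖Y t.toNNReal ω‖ₑ ^ n ∂P = ∫⁻ ω, ‖W t.toNNReal ω‖ₑ ^ n ∂P := by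
        refine lintegral_congr_ae ?_
        filter_upwards [hY] with ω hω
        rw [hω]
    _ = ∫⁻ x, ‖x‖ₑ ^ n ∂gaussianReal 0 t.toNNReal :=
        (hW.hasLaw_eval _).lintegral_comp (f := fun x => ‖x‖ₑ ^ n)
          (measurable_enorm.pow_const n).aemeasurable
    _ = ∫⁻ x, ‖√t‖ₑ ^ n * ‖x‖ₑ ^ n ∂gaussianReal 0 1 := by
        rw [hlaw, lintegral_map (measurable_enorm.pow_const n) (by fun_prop)]
        simp [enorm_mul, mul_pow]
    _ = ‖√t‖ₑ ^ n * ∫⁻ x, ‖x‖ₑ ^ n ∂gaussianReal 0 1 :=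
        lintegral_const_mul' _ _ (by finiteness)
    _ ≤ _ := by
        push_cast
        rw [ENNReal.coe_toNNReal hZ]
        gcongr
        rw [← ofReal_norm, Real.norm_of_nonneg (Real.sqrt_nonneg t)]
        exact ENNReal.ofReal_le_ofReal (Real.sqrt_le_sqrt ht.2)

/-- The case ρ = 1 makes the results on pairs apply to the past and the increments of a single
Brownian motion. -/
lemma _root_.ProbabilityTheory.IsBrownianReal.isCorrelatedBrownianPair_self {W : ℝ≥0 → Ω → ℝ}
    (hW : IsBrownianReal W P) : IsCorrelatedBrownianPair W W 1 P where
  brownian_fst := hW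
  brownian_snd := hW
  jointly_gaussian := by
    have := hW.isGaussianProcess.comp_right (Sum.elim id id : ℝ≥0 ⊕ ℝ≥0 → ℝ≥0)
    rwa [Sum.comp_elim] at this
  covariance_eq s t := by rw [hW.covariance_eval, one_mul]

variable [IsProbabilityMeasure P]

/-- Second moment of the solution of `dX = (F - γ X) dt + σ dW`, when the future increments of `W`
are orthogonal to the past of `F` and of `W`. -/
theorem integral_linearSolution_sq {F W : ℝ → Ω → ℝ} (hF : HasLocalMoments P F)
    (hW : HasLocalMoments P W) (γ σ x₀ : ℝ)
    (hW0 : ∀ t, 0 ≤ t → ∫ ω, W t ω ∂P = 0) (hW2 : ∀ t, 0 ≤ t → ∫ ω, W t ω ^ 2 ∂P = t)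
    (hFW : ∀ r u t, 0 ≤ r → r ≤ u → u ≤ t → ∫ ω, F r ω * (W t ω - W u ω) ∂P = 0)
    (hWW : ∀ r u t, 0 ≤ r → r ≤ u → u ≤ t → ∫ ω, W r ω * (W t ω - W u ω) ∂P = 0)
    {t : ℝ} (ht : 0 ≤ t) :
    ∫ ω, linearSolution γ σ x₀ (F · ω) (W · ω) t ^ 2 ∂P = Real.exp (-(2 * γ) * t) * x₀ ^ 2 +
      ∫ u in (0 : ℝ)..t, Real.exp (2 * γ * (u - t)) *
        (2 * (∫ ω, linearSolution γ σ x₀ (F · ω) (W · ω) u * F u ω ∂P) + σ ^ 2) := by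
  set X : ℝ → Ω → ℝ := fun t ω => linearSolution γ σ x₀ (F · ω) (W · ω) t with hX
  have hXm : HasLocalMoments P X := hF.linearSolution hW γ σ x₀
  set b : ℝ → Ω → ℝ := fun t ω => F t ω - γ * X t ω with hb
  have hbm : HasLocalMoments P b := hF.sub (hXm.const_mul γ)
  set A : ℝ → Ω → ℝ := fun t ω => X t ω - σ * W t ω with hA
  have hAm : HasLocalMoments P A := hXm.sub (hW.const_mul σ)
  have hA_deriv (ω : Ω) (s : ℝ) : HasDerivAt (fun t => A t ω) (b s ω) s :=
    hasDerivAt_linearSolution_sub (hF.continuous_path ω) (hW.continuous_path ω) s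
  have hA_zero (ω : Ω) : A 0 ω = x₀ := by simp [hA, hX, linearSolution]
  have hA_eq (ω : Ω) (s : ℝ) : A s ω = x₀ + ∫ u in (0 : ℝ)..s, b u ω := by
    rw [intervalIntegral.integral_eq_sub_of_hasDerivAt (fun u _ => hA_deriv ω u)
      ((hbm.continuous_path ω).intervalIntegrable _ _), hA_zero]
    ring
  have hA_sq (ω : Ω) (s : ℝ) : A s ω ^ 2 = x₀ ^ 2 + ∫ u in (0 : ℝ)..s, 2 * (A u ω * b u ω) := by
    have hd (u : ℝ) : HasDerivAt (fun t => A t ω ^ 2) (2 * (A u ω * b u ω)) u := by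
      refine ((hA_deriv ω u).pow 2).congr_deriv ?_
      simp [mul_assoc]
    rw [intervalIntegral.integral_eq_sub_of_hasDerivAt (fun u _ => hd u)
      ((((hAm.mul hbm).const_mul 2).continuous_path ω).intervalIntegrable _ _), hA_zero]
    ring
  -- The future increment is orthogonal to F at time u by hypothesis, and to X at time u because X
  -- is affine in the past of F and W.
  have hb_orth (u s : ℝ) (hu : 0 ≤ u) (hus : u ≤ s) : ∫ ω, b u ω * (W s ω - W u ω) ∂P = 0 := by
    have hZ : HasLocalMoments P fun _ ω => W s ω - W u ω :=
      (hW.fixed (hu.trans hus)).sub (hW.fixed hu)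
    have hXZ : ∫ ω, X u ω * (W s ω - W u ω) ∂P = 0 := by
      refine integral_linearSolution_mul_eq_zero hF hW γ σ x₀ hZ ?_ hu
        (fun r hr => hFW r u s hr.1 hr.2 hus) (fun r hr => hWW r u s hr.1 hr.2 hus)
      rw [integral_sub (hW.integrable (hu.trans hus)) (hW.integrable hu), hW0 s (hu.trans hus),
        hW0 u hu, sub_zero]
    calc _ = ∫ ω, (F u ω * (W s ω - W u ω) - γ * (X u ω * (W s ω - W u ω))) ∂P := by
          congr with ω; simp only [hb]; ring
      _ = 0 := by
        rw [integral_sub ((hF.mul hZ).integrable hu) (((hXm.mul hZ).integrable hu).const_mul γ),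
          integral_const_mul, hFW u u s hu le_rfl hus, hXZ]
        simp
  have hbW (u s : ℝ) (hu : 0 ≤ u) (hus : u ≤ s) :
      ∫ ω, b u ω * W s ω ∂P = ∫ ω, b u ω * W u ω ∂P := by
    rw [← sub_eq_zero, ← integral_sub
      ((hbm.mul (hW.fixed (hu.trans hus))).integrable hu) ((hbm.mul hW).integrable hu),
      ← hb_orth u s hu hus]
    congr with ω
    ring
  -- Here W is taken at the final time s, a constant in the inner integral; orthogonality then
  -- lowers its time to u.
  have hAW (s : ℝ) (hs : 0 ≤ s) :
      ∫ ω, A s ω * W s ω ∂P = ∫ u in (0 : ℝ)..s, ∫ ω, b u ω * W u ω ∂P := by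
    have hWs := hW.fixed hs
    calc ∫ ω, A s ω * W s ω ∂P
        = ∫ ω, (x₀ * W s ω + ∫ u in (0 : ℝ)..s, b u ω * W s ω) ∂P := by
          congr with ω
          rw [hA_eq, intervalIntegral.integral_mul_const, add_mul]
      _ = ∫ u in (0 : ℝ)..s, ∫ ω, b u ω * W s ω ∂P := by
          rw [integral_add ((hW.integrable hs).const_mul x₀)
            ((hbm.mul hWs).primitive.integrable hs), integral_const_mul, hW0 s hs, mul_zero,
            zero_add, (hbm.mul hWs).integral_primitive hs]
      _ = _ := by
          refine intervalIntegral.integral_congr fun u hu => ?_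
          rw [Set.uIcc_of_le hs] at hu
          exact hbW u s hu.1 hu.2
  have hAA (s : ℝ) (hs : 0 ≤ s) :
      ∫ ω, A s ω ^ 2 ∂P = x₀ ^ 2 + ∫ u in (0 : ℝ)..s, 2 * ∫ ω, A u ω * b u ω ∂P := by
    have hm := (hAm.mul hbm).const_mul 2
    simp_rw [hA_sq]
    rw [integral_add (integrable_const _) (hm.primitive.integrable hs), hm.integral_primitive hs]
    simp [integral_const_mul]
  have hXF := (hXm.mul hF).intervalIntegrable_integral ht
  refine eq_exp_mul_add_integral (c := 2 * γ) (m := fun s => ∫ ω, X s ω ^ 2 ∂P)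
    ((hXF.const_mul 2).add intervalIntegrable_const) (hXm.pow_two.intervalIntegrable_integral ht)
    fun s hs => ?_
  rw [Set.uIcc_of_le ht] at hs
  have hs := hs.1
  have hAb := (hAm.mul hbm).intervalIntegrable_integral hs
  have hbW' := (hbm.mul hW).intervalIntegrable_integral hs
  calc ∫ ω, X s ω ^ 2 ∂P
      = ∫ ω, (A s ω ^ 2 + 2 * σ * (A s ω * W s ω) + σ ^ 2 * W s ω ^ 2) ∂P := by
        congr with ω; simp only [hA]; ring
    _ = x₀ ^ 2 + (∫ u in (0 : ℝ)..s, 2 * ∫ ω, A u ω * b u ω ∂P) +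
          2 * σ * (∫ u in (0 : ℝ)..s, ∫ ω, b u ω * W u ω ∂P) + σ ^ 2 * s := by
        have h1 := hAm.pow_two.integrable hs
        have h2 := ((hAm.mul hW).integrable hs).const_mul (2 * σ)
        have h3 := (hW.pow_two.integrable hs).const_mul (σ ^ 2)
        rw [integral_add (by exact h1.add h2) h3, integral_add h1 h2, integral_const_mul,
          integral_const_mul, hAA s hs, hAW s hs, hW2 s hs]
    _ = x₀ ^ 2 + ∫ u in (0 : ℝ)..s, (2 * (∫ ω, A u ω * b u ω ∂P) +
          2 * σ * (∫ ω, b u ω * W u ω ∂P) + σ ^ 2) := by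
        rw [intervalIntegral.integral_add ((hAb.const_mul 2).add (hbW'.const_mul (2 * σ)))
          intervalIntegrable_const, intervalIntegral.integral_add (hAb.const_mul 2)
          (hbW'.const_mul (2 * σ)), intervalIntegral.integral_const_mul (2 * σ)]
        simp
        ring
    _ = _ := by
        congr 1
        refine intervalIntegral.integral_congr fun u hu => ?_
        rw [Set.uIcc_of_le hs] at hu
        have hu := hu.1
        have h1 := ((hAm.mul hbm).integrable hu).const_mul 2
        have h2 := ((hbm.mul hW).integrable hu).const_mul (2 * σ)
        have h3 := ((hXm.mul hF).integrable hu).const_mul 2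
        have h4 := (hXm.pow_two.integrable hu).const_mul (2 * γ)
        -- Since A + σW = X, the two terms combine to 2Xb = 2XF - 2γX².
        have key : (∫ ω, 2 * (A u ω * b u ω) ∂P) + ∫ ω, 2 * σ * (b u ω * W u ω) ∂P =
            (∫ ω, 2 * (X u ω * F u ω) ∂P) - ∫ ω, 2 * γ * X u ω ^ 2 ∂P := by
          rw [← integral_add h1 h2, ← integral_sub h3 h4]
          congr with ω
          simp only [hA, hb]
          ring
        simp only [integral_const_mul] at key
        linear_combination key

/-- For r ≤ u ≤ t the covariance of W₁(r) with the increment is ρr - ρr = 0, and jointly Gaussian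
uncorrelated families are independent. Mere uncorrelatedness would not suffice, as the forcing of V
is quadratic in the past of Ws. -/
lemma IsCorrelatedBrownianPair.indepFun_past_increment {W₁ W₂ : ℝ≥0 → Ω → ℝ} {ρ : ℝ}
    (h : IsCorrelatedBrownianPair W₁ W₂ ρ P) {u t : ℝ≥0} (hut : u ≤ t) :
    IndepFun (fun ω (r : Set.Iic u) => W₁ r ω) (fun ω (_ : Unit) => W₂ t ω - W₂ u ω) P := by
  have m1 := h.brownian_fst.aemeasurable
  have m2 := h.brownian_snd.aemeasurable
  have hfst := h.brownian_fst
  have hsnd := h.brownian_snd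
  have hjoint := h.jointly_gaussian
  have L1 (r : ℝ≥0) := (hfst.isGaussianProcess.hasGaussianLaw_eval r).memLp_two
  have L2 (r : ℝ≥0) := (hsnd.isGaussianProcess.hasGaussianLaw_eval r).memLp_two
  refine IsGaussianProcess.indepFun_of_covariance_eq_zero
    (X := fun (r : Set.Iic u) ω => W₁ r ω) (Y := fun (_ : Unit) ω => W₂ t ω - W₂ u ω)
    (hjoint.of_isGaussianProcess ?_) (fun r => m1 r) (fun _ => (m2 t).sub (m2 u)) ?_
  -- Each coordinate is a linear function of one or two values of the joint process, hence the
  -- combined family is Gaussian.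
  · rintro (⟨r, hr⟩ | _)
    · exact ⟨{.inl r},
        { toFun x := x ⟨.inl r, by simp⟩
          map_add' x y := by simp
          map_smul' c x := by simp }, by simp⟩
    · exact ⟨{.inr t, .inr u},
        { toFun x := x ⟨.inr t, by simp⟩ - x ⟨.inr u, by simp⟩
          map_add' x y := by simp; ring
          map_smul' c x := by simp; ring }, by simp⟩
  · rintro ⟨r, hr : r ≤ u⟩ _
    rw [covariance_fun_sub_right (L1 r) (L2 t) (L2 u), h.covariance_eq, h.covariance_eq,
      min_eq_left hr, min_eq_left (hr.trans hut), sub_self]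

lemma IsCorrelatedBrownianPair.integral_mul_increment {W₁ W₂ : ℝ≥0 → Ω → ℝ} {ρ : ℝ}
    (h : IsCorrelatedBrownianPair W₁ W₂ ρ P) {p u t : ℝ≥0} (hpu : p ≤ u) (hut : u ≤ t) :
    ∫ ω, W₁ p ω * (W₂ t ω - W₂ u ω) ∂P = 0 := by
  have hφ : Measurable fun x : Set.Iic u → ℝ => x ⟨p, hpu⟩ := by fun_prop
  have hψ : Measurable fun x : Unit → ℝ => x () := by fun_prop
  have hi := (h.indepFun_past_increment hut).comp hφ hψ
  have := hi.integral_fun_mul_eq_mul_integral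
    (h.brownian_fst.aemeasurable p).aestronglyMeasurable
    ((h.brownian_snd.aemeasurable t).sub (h.brownian_snd.aemeasurable u)).aestronglyMeasurable
  simpa [Function.comp_def, h.brownian_fst.integral_eval] using this

lemma IsCorrelatedBrownianPair.integral_mul_mul_increment {W₁ W₂ : ℝ≥0 → Ω → ℝ} {ρ : ℝ}
    (h : IsCorrelatedBrownianPair W₁ W₂ ρ P) {p q u t : ℝ≥0} (hpu : p ≤ u) (hqu : q ≤ u)
    (hut : u ≤ t) :
    ∫ ω, W₁ p ω * (W₁ q ω * (W₂ t ω - W₂ u ω)) ∂P = 0 := by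
  have hφ : Measurable fun x : Set.Iic u → ℝ => x ⟨p, hpu⟩ * x ⟨q, hqu⟩ := by fun_prop
  have hψ : Measurable fun x : Unit → ℝ => x () := by fun_prop
  have hi := (h.indepFun_past_increment hut).comp hφ hψ
  have := hi.integral_fun_mul_eq_mul_integral
    ((h.brownian_fst.aemeasurable p).mul (h.brownian_fst.aemeasurable q)).aestronglyMeasurable
    ((h.brownian_snd.aemeasurable t).sub (h.brownian_snd.aemeasurable u)).aestronglyMeasurable
  simpa [Function.comp_def, mul_assoc, integral_sub (h.brownian_snd.integrable_eval t)
    (h.brownian_snd.integrable_eval u), h.brownian_snd.integral_eval] using this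

end SSV

/-! ### The sentiment-volatility system -/

namespace SSV

variable {Ω : Type*} [MeasurableSpace Ω] {P : Measure Ω}

lemma SolvesAdditiveSDE.eq_linearSolution {X W : ℝ≥0 → Ω → ℝ} {x₀ σ γ : ℝ} {b : ℝ≥0 → Ω → ℝ}
    (h : SolvesAdditiveSDE X x₀ b σ W P) {F w : ℝ → Ω → ℝ} (hF : ∀ ω, Continuous (F · ω))
    (hw : ∀ᵐ ω ∂P, ∀ t : ℝ≥0, W t ω = w t ω)
    (hb : ∀ᵐ ω ∂P, ∀ t : ℝ≥0, b t ω = F t ω - γ * X t ω) :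
    ∀ᵐ ω ∂P, ∀ t : ℝ≥0, X t ω = linearSolution γ σ x₀ (F · ω) (w · ω) t := by
  filter_upwards [h.continuous_paths, h.integral_eq, hw, hb] with ω hc hX hw hb t
  have key := SSV.eq_linearSolution (γ := γ) (σ := σ) (x₀ := x₀) (f := (F · ω)) (w := (w · ω))
    (x := fun u => X u.toNNReal ω) (hF ω) (hc.comp continuous_real_toNNReal) (fun s hs => ?_)
    t.coe_nonneg
  · simpa using key
  · lift s to ℝ≥0 using hs
    simp only [Real.toNNReal_coe]
    rw [hX s, hw s]
    congr 2
    refine intervalIntegral.integral_congr fun u hu => ?_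
    rw [Set.uIcc_of_le s.coe_nonneg] at hu
    simp only [hb, Real.coe_toNNReal u hu.1]

variable [IsProbabilityMeasure P]

lemma _root_.ProbabilityTheory.IsBrownianReal.integral_sq {W : ℝ≥0 → Ω → ℝ}
    (hW : IsBrownianReal W P) (t : ℝ≥0) : ∫ ω, W t ω ^ 2 ∂P = t := by
  have hL := (hW.isGaussianProcess.hasGaussianLaw_eval t).memLp_two
  have h := hW.covariance_eval t t
  rw [covariance_eq_sub hL hL, hW.integral_eval] at h
  simpa [sq] using h

/-- The squared distance of the sentiment to its mean is orthogonal to the future increments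
of the volatility noise. -/
lemma integral_sentiment_sq_mul_eq_zero {w : ℝ → Ω → ℝ} (hw : HasLocalMoments P w)
    (lamS muS sigS S₀ c₀ c₁ : ℝ) {Z : Ω → ℝ} (hZ : HasLocalMoments P fun _ => Z)
    (hZ0 : ∫ ω, Z ω ∂P = 0) {u : ℝ} (hu : 0 ≤ u)
    (h1 : ∀ p ∈ Set.Icc 0 u, ∫ ω, w p ω * Z ω ∂P = 0)
    (h2 : ∀ p ∈ Set.Icc 0 u, ∀ q ∈ Set.Icc 0 u, ∫ ω, w p ω * (w q ω * Z ω) ∂P = 0) :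
    ∫ ω, (c₀ + c₁ * (linearSolution lamS sigS S₀ (fun _ => lamS * muS) (w · ω) u - muS) ^ 2) *
      Z ω ∂P = 0 := by
  have hc : HasLocalMoments P fun _ _ => lamS * muS := .of_continuous continuous_const
  set S : ℝ → Ω → ℝ := fun t ω => linearSolution lamS sigS S₀ (fun _ => lamS * muS) (w · ω) t
    with hS
  have hSm : HasLocalMoments P S := hc.linearSolution hw lamS sigS S₀
  have orth {Y : Ω → ℝ} (hY : HasLocalMoments P fun _ => Y) (hY0 : ∫ ω, Y ω ∂P = 0)
      (hwY : ∀ p ∈ Set.Icc 0 u, ∫ ω, w p ω * Y ω ∂P = 0) : ∫ ω, S u ω * Y ω ∂P = 0 :=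
    integral_linearSolution_mul_eq_zero hc hw lamS sigS S₀ hY hY0 hu
      (fun r _ => by rw [integral_const_mul, hY0, mul_zero]) hwY
  have hSZ : ∫ ω, S u ω * Z ω ∂P = 0 := orth hZ hZ0 h1
  -- `orth` is used twice: with Y = S_u Z, which requires E[w_p S_u Z] = 0, and then with Y = w_p Z,
  -- which reduces this to products of two values of w.
  have hSSZ : ∫ ω, S u ω * (S u ω * Z ω) ∂P = 0 := by
    refine orth ((hSm.fixed hu).mul hZ) hSZ fun p hp => ?_
    rw [← orth ((hw.fixed hp.1).mul hZ) (h1 p hp) fun q hq => h2 q hq p hp]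
    congr with ω
    ring
  have i0 := (hZ.integrable hu).const_mul (c₀ + c₁ * muS ^ 2)
  have i1 := ((hSm.mul hZ).integrable hu).const_mul (2 * c₁ * muS)
  have i2 := ((hSm.mul (hSm.mul hZ)).integrable hu).const_mul c₁
  calc _ = ∫ ω, ((c₀ + c₁ * muS ^ 2) * Z ω - 2 * c₁ * muS * (S u ω * Z ω) +
        c₁ * (S u ω * (S u ω * Z ω))) ∂P := by congr with ω; simp only [hS]; ring
    _ = 0 := by
      rw [integral_add (by exact i0.sub i1) i2, integral_sub i0 i1, integral_const_mul,
        integral_const_mul, integral_const_mul, hZ0, hSZ, hSSZ]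
      simp

end SSV

theorem mainTheorem7 {Ω : Type*} [MeasurableSpace Ω] (P : Measure Ω) [IsProbabilityMeasure P]
    (lamS muS sigS muV betaV gamV sigV rho S₀ V₀ : ℝ)
    (Ws Wv S V : ℝ≥0 → Ω → ℝ)
    (hSV : SSV.IsSentimentVolatility lamS muS sigS muV betaV gamV sigV rho S₀ V₀ Ws Wv S V P) :
    (∀ t : ℝ≥0,
      Integrable (fun ω => V t ω ^ 2) P ∧
      Integrable (fun ω => V t ω) P ∧
      Integrable (fun ω => S t ω * V t ω) P ∧
      Integrable (fun ω => S t ω ^ 2 * V t ω) P) ∧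
    ∀ t : ℝ≥0,
      IntervalIntegrable
        (fun u : ℝ => Real.exp (2 * gamV * (u - t)) *
          (2 * (muV + betaV * muS ^ 2) * (∫ ω, V u.toNNReal ω ∂P)
            - 4 * betaV * muS * (∫ ω, S u.toNNReal ω * V u.toNNReal ω ∂P)
            + 2 * betaV * (∫ ω, S u.toNNReal ω ^ 2 * V u.toNNReal ω ∂P)
            + sigV ^ 2)) volume 0 t ∧
      ∫ ω, V t ω ^ 2 ∂P =
        Real.exp (-2 * gamV * t) * V₀ ^ 2 +
          ∫ u in (0 : ℝ)..t, Real.exp (2 * gamV * (u - t)) *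
            (2 * (muV + betaV * muS ^ 2) * (∫ ω, V u.toNNReal ω ∂P)
              - 4 * betaV * muS * (∫ ω, S u.toNNReal ω * V u.toNNReal ω ∂P)
              + 2 * betaV * (∫ ω, S u.toNNReal ω ^ 2 * V u.toNNReal ω ∂P)
              + sigV ^ 2) := by
  obtain ⟨hN, hS, hV⟩ := hSV
  obtain ⟨ws, hws, hWs⟩ := hN.brownian_fst.exists_hasLocalMoments
  obtain ⟨wv, hwv, hWv⟩ := hN.brownian_snd.exists_hasLocalMoments
  have hself := hN.brownian_snd.isCorrelatedBrownianPair_self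
  have hc (c : ℝ) : SSV.HasLocalMoments P fun _ _ => c := .of_continuous continuous_const
  set s : ℝ → Ω → ℝ := fun t ω => SSV.linearSolution lamS sigS S₀ (fun _ => lamS * muS) (ws · ω) t
    with hs_def
  have hs : SSV.HasLocalMoments P s := (hc (lamS * muS)).linearSolution hws lamS sigS S₀
  set F : ℝ → Ω → ℝ := fun t ω => muV + betaV * (s t ω - muS) ^ 2 with hF_def
  have hF : SSV.HasLocalMoments P F :=
    (hc muV).add ((hs.sub (hc muS)).pow_two.const_mul betaV)
  set v : ℝ → Ω → ℝ := fun t ω => SSV.linearSolution gamV sigV V₀ (F · ω) (wv · ω) t with hv_def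
  have hv : SSV.HasLocalMoments P v := hF.linearSolution hwv gamV sigV V₀
  have hSs : ∀ᵐ ω ∂P, ∀ t : ℝ≥0, S t ω = s t ω :=
    hS.eq_linearSolution (F := fun _ _ => lamS * muS) (fun _ => continuous_const) hWs
      (.of_forall fun ω t => by ring)
  have hVv : ∀ᵐ ω ∂P, ∀ t : ℝ≥0, V t ω = v t ω :=
    hV.eq_linearSolution hF.continuous_path hWv (by
      filter_upwards [hSs] with ω hω t
      simp only [hF_def, hω t])
  have e0 (t : ℝ≥0) : V t =ᵐ[P] v t := hVv.mono fun ω h => h t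
  have e1 (t : ℝ≥0) : (fun ω => S t ω * V t ω) =ᵐ[P] fun ω => s t ω * v t ω := by
    filter_upwards [hSs, hVv] with ω h h'
    rw [h, h']
  have e2 (t : ℝ≥0) : (fun ω => S t ω ^ 2 * V t ω) =ᵐ[P] fun ω => s t ω ^ 2 * v t ω := by
    filter_upwards [hSs, hVv] with ω h h'
    rw [h, h']
  have e3 (t : ℝ≥0) : (fun ω => V t ω ^ 2) =ᵐ[P] fun ω => v t ω ^ 2 := by
    filter_upwards [hVv] with ω h
    rw [h]
  have hsv := hs.mul hv
  have hssv := hs.pow_two.mul hv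
  refine ⟨fun t => ⟨(hv.pow_two.integrable t.coe_nonneg).congr (e3 t).symm,
    (hv.integrable t.coe_nonneg).congr (e0 t).symm,
    (hsv.integrable t.coe_nonneg).congr (e1 t).symm,
    (hssv.integrable t.coe_nonneg).congr (e2 t).symm⟩, fun t => ?_⟩
  -- Expansion of 2vF with F = μ_v + β_v (s - μ_s)², which produces the three coefficients of the
  -- statement.
  have hG (u : ℝ) (hu : 0 ≤ u) : 2 * (muV + betaV * muS ^ 2) * (∫ ω, V u.toNNReal ω ∂P)
      - 4 * betaV * muS * (∫ ω, S u.toNNReal ω * V u.toNNReal ω ∂P)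
      + 2 * betaV * (∫ ω, S u.toNNReal ω ^ 2 * V u.toNNReal ω ∂P) + sigV ^ 2 =
      2 * (∫ ω, v u ω * F u ω ∂P) + sigV ^ 2 := by
    rw [integral_congr_ae (e0 _), integral_congr_ae (e1 _), integral_congr_ae (e2 _),
      Real.coe_toNNReal u hu]
    have i0 := (hv.integrable hu).const_mul (2 * (muV + betaV * muS ^ 2))
    have i1 := (hsv.integrable hu).const_mul (4 * betaV * muS)
    have i2 := (hssv.integrable hu).const_mul (2 * betaV)
    rw [← integral_const_mul, ← integral_const_mul, ← integral_const_mul, ← integral_const_mul,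
      ← integral_sub i0 i1, ← integral_add (by exact i0.sub i1) i2]
    congr 2 with ω
    simp only [hF_def]
    ring
  have hvF := (hv.mul hF).intervalIntegrable_integral t.coe_nonneg
  constructor
  · refine IntervalIntegrable.congr (f := fun u : ℝ => Real.exp (2 * gamV * (u - t)) *
      (2 * (∫ ω, v u ω * F u ω ∂P) + sigV ^ 2)) (fun u hu => ?_) ?_
    · rw [Set.uIoc_of_le t.coe_nonneg] at hu
      simp only [hG u hu.1.le]
    · exact ((hvF.const_mul 2).add intervalIntegrable_const).continuousOn_mul
        (by fun_prop)
  · have mean_v (r : ℝ) (hr : 0 ≤ r) : ∫ ω, wv r ω ∂P = 0 := by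
      lift r to ℝ≥0 using hr
      rw [← hN.brownian_snd.integral_eval r]
      exact integral_congr_ae (hWv.mono fun ω h => (h r).symm)
    have mean_inc (u r : ℝ) (hu : 0 ≤ u) (hur : u ≤ r) : ∫ ω, (wv r ω - wv u ω) ∂P = 0 := by
      rw [integral_sub (hwv.integrable (hu.trans hur)) (hwv.integrable hu),
        mean_v r (hu.trans hur), mean_v u hu, sub_zero]
    rw [integral_congr_ae (e3 t), intervalIntegral.integral_congr (g := fun u : ℝ =>
      Real.exp (2 * gamV * (u - t)) * (2 * (∫ ω, v u ω * F u ω ∂P) + sigV ^ 2))]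
    · rw [neg_mul]
      refine SSV.integral_linearSolution_sq hF hwv gamV sigV V₀ mean_v (fun r hr => ?_)
        (fun r u q hr hru huq => ?_) (fun r u q hr hru huq => ?_) t.coe_nonneg
      · lift r to ℝ≥0 using hr
        refine (integral_congr_ae (hWv.mono fun ω h => ?_)).trans (hN.brownian_snd.integral_sq r)
        simp only [h r]
      -- Orthogonality of F to the increments of Wv: only the past of Ws enters, through one or two
      -- of its values.
      · have hu := hr.trans hru
        have hq := hu.trans huq
        refine SSV.integral_sentiment_sq_mul_eq_zero hws lamS muS sigS S₀ muV betaV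
          ((hwv.fixed hq).sub (hwv.fixed hu)) (mean_inc u q hu huq) hr (fun p hp => ?_)
          fun p hp p' hp' => ?_
        · have hpu := hp.2.trans hru
          have hp := hp.1
          lift p to ℝ≥0 using hp
          lift u to ℝ≥0 using hu
          lift q to ℝ≥0 using hq
          rw [← hN.integral_mul_increment (NNReal.coe_le_coe.1 hpu) (NNReal.coe_le_coe.1 huq)]
          refine integral_congr_ae ?_
          filter_upwards [hWs, hWv] with ω h h'
          rw [h, h', h']
        · have hpu := hp.2.trans hru
          have hp := hp.1
          have hpu' := hp'.2.trans hru
          have hp' := hp'.1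
          lift p to ℝ≥0 using hp
          lift p' to ℝ≥0 using hp'
          lift u to ℝ≥0 using hu
          lift q to ℝ≥0 using hq
          rw [← hN.integral_mul_mul_increment (NNReal.coe_le_coe.1 hpu)
            (NNReal.coe_le_coe.1 hpu') (NNReal.coe_le_coe.1 huq)]
          refine integral_congr_ae ?_
          filter_upwards [hWs, hWv] with ω h h'
          rw [h, h, h', h']
      -- Orthogonality of Wv to its own later increments, from the pair (Wv, Wv).
      · have hu := hr.trans hru
        have hq := hu.trans huq
        lift r to ℝ≥0 using hr
        lift u to ℝ≥0 using hu
        lift q to ℝ≥0 using hq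
        rw [← hself.integral_mul_increment (NNReal.coe_le_coe.1 hru) (NNReal.coe_le_coe.1 huq)]
        refine integral_congr_ae ?_
        filter_upwards [hWv] with ω h
        rw [h, h, h]
    · intro u hu
      rw [Set.uIcc_of_le t.coe_nonneg] at hu
      simp only [hG u hu.1]
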